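/- Let $A$ be a band operator on $\ell^2(\mathbb Z)$, i.e. a bounded linear operator whose matrix $(a_{ij})_{i,j\in\mathbb Z}$ is supported on finitely many diagonals, let $b\ge 1$ be an integer with $b\ge\max\{|i-j|:a_{ij}\ne0\}$, let $N\ge1$ and $n=Nb$. For $c\in\{0,\dots,b-1\}$ and $k,l\in\mathbb Z$ let $A^{(c)}_{k,l}=(a_{c+bk+p,\,c+bl+q})_{p,q=1}^{b}$, so that $A$ is block-tridiagonal with blocks $A^{(c)}_{k,l}$ for every offset $c$, and put, with the spectral norm of matrices, $$\delta_c=\delta_c(N)=2\Big(\sup_{l\in\mathbb Z}\|A^{(c)}_{l+1,l}\|+\sup_{l\in\mathbb Z}\|A^{(c)}_{l-1,l}\|\Big)\sin\frac{\pi}{2N+2}.$$ For a bounded operator $B$ let $\nu(B)=\inf_{\|x\|=1}\|Bx\|$. For $\varepsilon>0$ let $\mathrm{spec}_\varepsilon A=\{\lambda\in\mathbb C:\|(A-\lambda I)^{-1}\|>1/\varepsilon\}$, where $\|B^{-1}\|=\infty$ if $B$ is not invertible, and $$\Gamma^{n,c}_\varepsilon(A)=\bigcup_{k\in c+b\mathbb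 Z}\Big\{\lambda\in\mathbb C:\min\big(\nu((A-\lambda I)|_{\ell^2(J^n_k)}),\ \nu((A-\lambda I)^*|_{\ell^2(J^n_k)})\big)<\varepsilon\Big\},\qquad J^n_k=\{k+1,\dots,k+n\},$$ where $\ell^2(J)$ denotes the subspace of sequences in $\ell^2(\mathbb Z)$ supported in $J$. Then, for every $\varepsilon>0$ and $N\ge 1$, $$\Gamma^{n,c}_\varepsilon(A)\subset\mathrm{spec}_\varepsilon A\subset\Gamma^{n,c}_{\varepsilon+\delta_c}(A)\qquad\text{for each }c\in\{0,\dots,b-1\},$$ and hence $$\bigcup_{c=0}^{b-1}\Gamma^{n,c}_\varepsilon(A)\ \subset\ \mathrm{spec}_\varepsilon A\ \subset\ \bigcap_{c=0}^{b-1}\Gamma^{n,c}_{\varepsilon+\delta_c}(A);$$ the second inclusion also holds with every $\delta_c$ replaced by the common value $\delta=\max_{c}\delta_c$. Moreover, for each $c$, $\delta_c(N)\in O(1/N)=O(1/n)$ as $N\to\infty$ with $A$ and $b$ fixed. -/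

import Mathlib

noncomputable section

namespace BandOp

/-- The Hilbert space `ℓ²(ℤ)` of square-summable bi-infinite complex sequences. -/
abbrev L2Z : Type := lp (fun _ : ℤ => ℂ) 2

/-- The entry `a_{ij}` of the bi-infinite matrix of `A`: the `i`-th coordinate of `A e_j`. -/
def entry (A : L2Z →L[ℂ] L2Z) (i j : ℤ) : ℂ :=
  (A (lp.single 2 j (1 : ℂ))) i

/-- A band operator: a bounded operator whose matrix is supported on finitely many diagonals.
(The matrix entries are uniformly bounded, because `A` is bounded.) -/
def IsBandOperator (A : L2Z →L[ℂ] L2Z) : Prop :=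
  {m : ℤ | ∃ i j : ℤ, entry A i j ≠ 0 ∧ m = i - j}.Finite

/-- The bandwidth `max {|i - j| : a_{ij} ≠ 0}` of a band operator (`0` for the zero operator). -/
def bandwidth (A : L2Z →L[ℂ] L2Z) : ℕ :=
  sSup {m : ℕ | ∃ i j : ℤ, entry A i j ≠ 0 ∧ m = (i - j).natAbs}

/-- The `ε`-pseudospectrum: all `lam` with `‖(A - lam I)⁻¹‖ > 1 / ε`, where the norm of the
inverse counts as infinite if `A - lam I` is not invertible. -/
def pseudospectrum (A : L2Z →L[ℂ] L2Z) (ε : ℝ) : Set ℂ :=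
  {lam : ℂ | ¬ IsUnit (A - lam • (1 : L2Z →L[ℂ] L2Z)) ∨
    1 / ε < ‖Ring.inverse (A - lam • (1 : L2Z →L[ℂ] L2Z))‖}

/-- The lower norm `ν(B) = inf {‖B x‖ : ‖x‖ = 1}`. -/
def lowerNorm {E F : Type*} [NormedAddCommGroup E] [NormedSpace ℂ E]
    [NormedAddCommGroup F] [NormedSpace ℂ F] (B : E →L[ℂ] F) : ℝ :=
  ⨅ x : {x : E // ‖x‖ = 1}, ‖B x‖

/-- The discrete interval `J^n_k = {k + 1, …, k + n}`. -/
def window (n : ℕ) (k : ℤ) : Set ℤ := Set.Icc (k + 1) (k + n)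

/-- `ℓ²(J)` as the subspace of all sequences in `ℓ²(ℤ)` that vanish outside `J`. -/
def l2On (J : Set ℤ) : Submodule ℂ L2Z where
  carrier := {x | ∀ j, j ∉ J → x j = 0}
  zero_mem' := fun _ _ => rfl
  add_mem' := by
    intro x y hx hy j hj
    have h1 : x j = 0 := hx j hj
    have h2 : y j = 0 := hy j hj
    simp [h1, h2]
  smul_mem' := by
    intro a x hx j hj
    have h1 : x j = 0 := hx j hj
    simp [h1]

/-- The restriction `B|_{ℓ²(J)} : ℓ²(J) → ℓ²(ℤ)`. -/
def restrictTo (B : L2Z →L[ℂ] L2Z) (J : Set ℤ) : l2On J →L[ℂ] L2Z :=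
  B.comp (l2On J).subtypeL

/-- `Γ^{n,M}_ε(A)`, for a set `M` of window positions. -/
def gammaSet (A : L2Z →L[ℂ] L2Z) (n : ℕ) (M : Set ℤ) (ε : ℝ) : Set ℂ :=
  ⋃ k ∈ M, {lam : ℂ |
    min (lowerNorm (restrictTo (A - lam • (1 : L2Z →L[ℂ] L2Z)) (window n k)))
      (lowerNorm (restrictTo
        (ContinuousLinearMap.adjoint (A - lam • (1 : L2Z →L[ℂ] L2Z))) (window n k))) < ε}

/-- The set `c + bℤ`. -/
def offsetSet (b : ℕ) (c : ℤ) : Set ℤ := {k : ℤ | ∃ z : ℤ, k = c + b * z}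

/-- The `b × b` block `A_{kl}` for the offset `c`: rows `c + bk + 1, …, c + bk + b` and
columns `c + bl + 1, …, c + bl + b` of the matrix of `A`. -/
def block (A : L2Z →L[ℂ] L2Z) (b : ℕ) (c k l : ℤ) : Matrix (Fin b) (Fin b) ℂ :=
  Matrix.of fun p q => entry A (c + b * k + 1 + (p : ℕ)) (c + b * l + 1 + (q : ℕ))

/-- The operator norm of a matrix with respect to the Euclidean norm on `ℂ^b`. -/
def opNorm {b : ℕ} (M : Matrix (Fin b) (Fin b) ℂ) : ℝ :=
  ‖Matrix.toEuclideanCLM (n := Fin b) (𝕜 := ℂ) M‖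

/-- The error bound
`2 (sup_l ‖A_{l+1,l}‖ + sup_l ‖A_{l-1,l}‖) sin (π / (2N + 2))` for the offset `c`. -/
def delta (A : L2Z →L[ℂ] L2Z) (b : ℕ) (c : ℤ) (N : ℕ) : ℝ :=
  2 * ((⨆ l : ℤ, opNorm (block A b c (l + 1) l)) + (⨆ l : ℤ, opNorm (block A b c (l - 1) l))) *
    Real.sin (Real.pi / (2 * N + 2))

end BandOp

end

/-!
By the Hilbert space formula for the norm of the inverse, `λ` lies in the `ε`-pseudospectrum iff
some `x` satisfies `‖(A - λ) x‖ < ε ‖x‖` or `‖(A - λ)* x‖ < ε ‖x‖`. If such an `x` is supported in a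
window, this is membership in `Γ`, which gives the lower inclusion.

For the upper inclusion, pass to blocks, so that `T = A - λ` becomes tridiagonal, and localize `x`
by the translates of a window function `w` supported on `N` consecutive blocks. The sequences
`x_m = w (· - m) • x` satisfy `∑ ‖x_m‖² = ‖w‖² ‖x‖²`, and `T x_m` differs from `w (· - m) • T x`
only by increments of `w` times off-diagonals of `T`. By the triangle inequality in
`ℓ²(ℤ, ℓ²(ℤ))`, some `m` satisfies `‖T x_m‖ < (ε + (α + β) τ) ‖x_m‖`, where `α` and `β` bound the
off-diagonals and `τ = ‖w (· + 1) - w‖ / ‖w‖`. This ratio is minimized by the ground state of the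
discrete Dirichlet Laplacian, a sine, for which it equals `2 sin (π / (2 N + 2))`.
-/

noncomputable section

open scoped ENNReal lp InnerProductSpace

namespace BandOp

section LowerNorm

variable {E F : Type*} [NormedAddCommGroup E] [NormedSpace ℂ E] [NormedAddCommGroup F]
  [NormedSpace ℂ F]

theorem le_lowerNorm_iff [Nontrivial E] (B : E →L[ℂ] F) {ε : ℝ} :
    ε ≤ lowerNorm B ↔ ∀ x, ε * ‖x‖ ≤ ‖B x‖ := by
  obtain ⟨e, he⟩ := exists_norm_eq E zero_le_one
  have : Nonempty {x : E // ‖x‖ = 1} := ⟨⟨e, he⟩⟩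
  have hbdd : BddBelow (Set.range fun x : {x : E // ‖x‖ = 1} ↦ ‖B x‖) :=
    ⟨0, Set.forall_mem_range.2 fun _ ↦ norm_nonneg _⟩
  rw [lowerNorm, le_ciInf_iff hbdd]
  refine ⟨fun h x ↦ ?_, fun h x ↦ by simpa [x.2] using h x⟩
  obtain rfl | hx := eq_or_ne x 0
  · simp
  have hunit : ‖((‖x‖⁻¹ : ℝ) : ℂ) • x‖ = 1 := by simp [norm_smul, hx]
  have hle := h ⟨_, hunit⟩
  rw [map_smul, norm_smul, Complex.norm_real, norm_inv, norm_norm, ← div_eq_inv_mul,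
    le_div_iff₀ (norm_pos_iff.2 hx)] at hle
  exact hle

theorem lowerNorm_lt_iff [Nontrivial E] (B : E →L[ℂ] F) {ε : ℝ} :
    lowerNorm B < ε ↔ ∃ x, ‖B x‖ < ε * ‖x‖ := by
  simpa only [not_le, not_forall] using (le_lowerNorm_iff B).not

end LowerNorm

section Pseudospectrum

variable {H : Type*} [NormedAddCommGroup H]

theorem norm_inverse_le_one_div_iff [NormedSpace ℂ H] {B : H →L[ℂ] H} (hB : IsUnit B) {ε : ℝ}
    (hε : 0 < ε) : ‖Ring.inverse B‖ ≤ 1 / ε ↔ ∀ x, ε * ‖x‖ ≤ ‖B x‖ := by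
  obtain ⟨u, rfl⟩ := hB
  have hinv (x : H) : (↑u⁻¹ : H →L[ℂ] H) ((u : H →L[ℂ] H) x) = x :=
    DFunLike.congr_fun u.inv_mul x
  have hsurj : Function.Surjective (u : H →L[ℂ] H) := fun y ↦
    ⟨(↑u⁻¹ : H →L[ℂ] H) y, DFunLike.congr_fun u.mul_inv y⟩
  rw [Ring.inverse_unit, ContinuousLinearMap.opNorm_le_iff (by positivity), hsurj.forall]
  refine forall_congr' fun x ↦ ?_
  rw [hinv, one_div_mul_eq_div, le_div_iff₀' hε]

variable [InnerProductSpace ℂ H] [CompleteSpace H]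

open ContinuousLinearMap

theorem isUnit_of_forall_mul_norm_le {B : H →L[ℂ] H} {ε : ℝ} (hε : 0 < ε)
    (h : ∀ x, ε * ‖x‖ ≤ ‖B x‖) (h' : ∀ x, ε * ‖x‖ ≤ ‖adjoint B x‖) : IsUnit B := by
  rw [isUnit_iff_bijective, bijective_iff_dense_range_and_antilipschitz,
    Submodule.topologicalClosure_eq_top_iff, orthogonal_range, LinearMap.ker_eq_bot']
  refine ⟨fun x (hx : adjoint B x = 0) ↦ ?_, (Real.toNNReal ε)⁻¹, ?_⟩
  · have hle := h' x
    rw [hx, norm_zero, mul_nonpos_iff_pos_imp_nonpos] at hle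
    exact norm_le_zero_iff.1 (hle.1 hε)
  · refine AddMonoidHomClass.antilipschitz_of_bound B fun x ↦ ?_
    rw [NNReal.coe_inv, Real.coe_toNNReal _ hε.le, ← div_eq_inv_mul, le_div_iff₀' hε]
    exact h x

theorem not_isUnit_or_lt_norm_inverse_iff [Nontrivial H] (B : H →L[ℂ] H) {ε : ℝ} (hε : 0 < ε) :
    (¬ IsUnit B ∨ 1 / ε < ‖Ring.inverse B‖) ↔
      min (lowerNorm B) (lowerNorm (adjoint B)) < ε := by
  rw [← not_iff_not, not_or, not_not, not_lt, not_lt, le_min_iff, le_lowerNorm_iff,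
    le_lowerNorm_iff]
  constructor
  · rintro ⟨hB, hle⟩
    refine ⟨(norm_inverse_le_one_div_iff hB hε).1 hle, ?_⟩
    rw [← star_eq_adjoint, ← norm_inverse_le_one_div_iff hB.star hε, Ring.inverse_star, norm_star]
    exact hle
  · rintro ⟨h, h'⟩
    have hB := isUnit_of_forall_mul_norm_le hε h h'
    exact ⟨hB, (norm_inverse_le_one_div_iff hB hε).2 h⟩

end Pseudospectrum

section SequenceSpaces

variable {ι κ E F : Type*} {p : ℝ≥0∞} [NormedAddCommGroup E] [NormedAddCommGroup F]
  [Fact (1 ≤ p)]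

theorem ne_zero_of_fact_one_le : p ≠ 0 :=
  (zero_lt_one.trans_le Fact.out).ne'

theorem toReal_pos_of_ne_top (hp : p ≠ ∞) : 0 < p.toReal :=
  ENNReal.toReal_pos ne_zero_of_fact_one_le hp

theorem exists_norm_apply_lt {X : ℓ^p(ι, E)} {Y : ℓ^p(ι, F)} {C : ℝ} (h : ‖Y‖ < C * ‖X‖) :
    ∃ i, ‖Y i‖ < C * ‖X i‖ := by
  by_contra! hle
  obtain hC | hC := lt_or_ge C 0
  · exact h.not_ge ((mul_nonpos_of_nonpos_of_nonneg hC.le (norm_nonneg X)).trans (norm_nonneg Y))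
  · have hmono : ‖C • lp.toNorm X‖ ≤ ‖Y‖ :=
      lp.norm_mono ne_zero_of_fact_one_le fun i ↦ by
        simpa [norm_smul, abs_of_nonneg hC] using hle i
    rw [norm_smul, lp.norm_toNorm, Real.norm_of_nonneg hC] at hmono
    exact h.not_ge hmono

theorem memℓp_comp_equiv (σ : ι ≃ κ) {f : κ → E} (hf : Memℓp f p) : Memℓp (f ∘ σ) p := by
  obtain rfl | hp := eq_or_ne p ∞
  · exact memℓp_infty (hf.bddAbove.mono (Set.range_comp_subset_range σ fun k ↦ ‖f k‖))
  · exact memℓp_gen (σ.summable_iff.2 (hf.summable (toReal_pos_of_ne_top hp)))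

theorem memℓp_prod_iff (hp : p ≠ ∞) {f : κ × ι → E} :
    Memℓp f p ↔ ∃ h : ∀ k, Memℓp (fun i ↦ f (k, i)) p,
      Memℓp (fun k ↦ (⟨_, h k⟩ : ℓ^p(ι, E))) p := by
  have hp := toReal_pos_of_ne_top hp
  simp only [memℓp_gen_iff hp, lp.norm_rpow_eq_tsum hp, exists_prop]
  exact summable_prod_of_nonneg fun _ ↦ by positivity

variable (𝕜 : Type*) [NormedField 𝕜] [NormedSpace 𝕜 E]

/-- Reindexing of `ℓ^p` sequences along a bijection `σ` of the index sets, `x ↦ x ∘ σ`. -/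
def reindex (σ : ι ≃ κ) : ℓ^p(κ, E) ≃ₗᵢ[𝕜] ℓ^p(ι, E) where
  toFun x := ⟨x ∘ σ, memℓp_comp_equiv σ x.2⟩
  invFun y := ⟨y ∘ σ.symm, memℓp_comp_equiv σ.symm y.2⟩
  left_inv x := by ext; simp
  right_inv y := by ext; simp
  map_add' x y := rfl
  map_smul' a x := rfl
  norm_map' x := by
    obtain rfl | hp := eq_or_ne p ∞
    · simp only [lp.norm_eq_ciSup]
      exact σ.iSup_comp (g := fun k ↦ ‖x k‖)
    · have hp := toReal_pos_of_ne_top hp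
      simp only [lp.norm_eq_tsum_rpow hp]
      congr 1
      exact σ.tsum_eq fun k ↦ ‖x k‖ ^ p.toReal

/-- For `p < ∞`, a `p`-summable family indexed by `κ × ι` is the same as a `p`-summable family
indexed by `κ` of `p`-summable families indexed by `ι`. -/
def curry (hp : p ≠ ∞) : ℓ^p(κ × ι, E) ≃ₗᵢ[𝕜] ℓ^p(κ, ℓ^p(ι, E)) where
  toFun x := ⟨fun k ↦ ⟨fun i ↦ x (k, i), ((memℓp_prod_iff hp).1 x.2).1 k⟩,
    ((memℓp_prod_iff hp).1 x.2).2⟩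
  invFun X := ⟨fun t ↦ X t.1 t.2, (memℓp_prod_iff hp).2 ⟨fun k ↦ (X k).2, X.2⟩⟩
  left_inv x := rfl
  right_inv X := rfl
  map_add' x y := rfl
  map_smul' a x := rfl
  norm_map' x := by
    have hp' := toReal_pos_of_ne_top hp
    rw [← Real.rpow_left_inj (norm_nonneg _) (norm_nonneg _) hp'.ne']
    simp only [lp.norm_rpow_eq_tsum hp']
    exact ((lp.memℓp x).summable hp').tsum_prod.symm

variable {𝕜}

theorem hasSum_norm_smul_rpow (hp : p ≠ ∞) (w : ℓ^p(ι, 𝕜)) (x : ℓ^p(κ, E)) :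
    HasSum (fun t : κ × ι ↦ ‖w t.2 • x t.1‖ ^ p.toReal) ((‖w‖ * ‖x‖) ^ p.toReal) := by
  have hp := toReal_pos_of_ne_top hp
  have hw := lp.hasSum_norm hp w
  have hx := lp.hasSum_norm hp x
  have h := hx.mul hw (hx.summable.mul_of_nonneg hw.summable (fun _ ↦ by positivity)
    fun _ ↦ by positivity)
  simpa only [norm_smul, Real.mul_rpow, norm_nonneg, mul_comm] using h

/-- The two-parameter family of products `w i • x k`, the tensor `x ⊗ w`. -/
def outerSMul (hp : p ≠ ∞) (w : ℓ^p(ι, 𝕜)) (x : ℓ^p(κ, E)) : ℓ^p(κ × ι, E) :=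
  ⟨fun t ↦ w t.2 • x t.1, memℓp_gen (hasSum_norm_smul_rpow hp w x).summable⟩

theorem norm_outerSMul (hp : p ≠ ∞) (w : ℓ^p(ι, 𝕜)) (x : ℓ^p(κ, E)) :
    ‖outerSMul hp w x‖ = ‖w‖ * ‖x‖ := by
  have hp' := toReal_pos_of_ne_top hp
  rw [← Real.rpow_left_inj (norm_nonneg _) (by positivity) hp'.ne', lp.norm_rpow_eq_tsum hp']
  exact (hasSum_norm_smul_rpow hp w x).tsum_eq

variable {G : Type*} [AddGroup G]

/-- The family of all localizations of the sequence `x` by translates of the window `w`: its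
`m`-th member is the sequence `k ↦ w (k - m) • x k`. -/
def localizations (hp : p ≠ ∞) (w : ℓ^p(G, 𝕜)) (x : ℓ^p(G, E)) : ℓ^p(G, ℓ^p(G, E)) :=
  curry 𝕜 hp (reindex 𝕜 ((Equiv.prodComm G G).trans ((Equiv.refl G).prodShear Equiv.subLeft))
    (outerSMul hp w x))

@[simp]
theorem localizations_apply (hp : p ≠ ∞) (w : ℓ^p(G, 𝕜)) (x : ℓ^p(G, E)) (m k : G) :
    localizations hp w x m k = w (k - m) • x k :=
  rfl

theorem norm_localizations (hp : p ≠ ∞) (w : ℓ^p(G, 𝕜)) (x : ℓ^p(G, E)) :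
    ‖localizations hp w x‖ = ‖w‖ * ‖x‖ := by
  rw [localizations, LinearIsometryEquiv.norm_map, LinearIsometryEquiv.norm_map, norm_outerSMul]

variable (𝕜) in
/-- Translation by `s`, `x ↦ x (· + s)`. -/
def shift (s : G) : ℓ^p(G, E) ≃ₗᵢ[𝕜] ℓ^p(G, E) :=
  reindex 𝕜 (Equiv.addRight s)

variable (𝕜) in
@[simp]
theorem shift_apply (s : G) (x : ℓ^p(G, E)) (k : G) : shift 𝕜 s x k = x (k + s) :=
  rfl

end SequenceSpaces

section Localization

variable {𝕜 E : Type*} [NontriviallyNormedField 𝕜] [NormedAddCommGroup E] [NormedSpace 𝕜 E]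
  {p : ℝ≥0∞} [Fact (1 ≤ p)] {α β τ ε : ℝ} {L D U : ℤ → E →L[𝕜] E}
  {T : ℓ^p(ℤ, E) → ℓ^p(ℤ, E)}

-- Commuting `T` past the window `w (· - m)` costs only the increments of `w`, which meet the two
-- off-diagonals `L` and `U`.
theorem apply_localizations_eq_add (hp : p ≠ ∞) (hα : 0 ≤ α) (hβ : 0 ≤ β) (hL : ∀ k, ‖L k‖ ≤ α)
    (hU : ∀ k, ‖U k‖ ≤ β)
    (hT : ∀ x k, T x k = L k (x (k - 1)) + D k (x k) + U k (x (k + 1)))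
    (w : ℓ^p(ℤ, 𝕜)) (x : ℓ^p(ℤ, E)) (m : ℤ) :
    T (localizations hp w x m) =
      (localizations hp w (T x) +
        localizations hp (shift 𝕜 (-1) w - w) (lp.mapCLM p L hα hL (shift 𝕜 (-1) x)) +
        localizations hp (shift 𝕜 1 w - w) (lp.mapCLM p U hβ hU (shift 𝕜 1 x))) m := by
  ext k
  have hpred : k - m + -1 = k - 1 - m := by ring
  have hsucc : k - m + 1 = k + 1 - m := by ring
  simp only [hT, localizations_apply, map_smul, lp.coeFn_add, lp.coeFn_sub, Pi.add_apply,
    Pi.sub_apply, shift_apply, lp.mapCLM_apply_coe, hpred, hsucc, sub_eq_add_neg k 1]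
  module

theorem exists_norm_apply_localizations_lt (hp : p ≠ ∞) (hL : ∀ k, ‖L k‖ ≤ α)
    (hU : ∀ k, ‖U k‖ ≤ β)
    (hT : ∀ x k, T x k = L k (x (k - 1)) + D k (x k) + U k (x (k + 1)))
    {w : ℓ^p(ℤ, 𝕜)} (hw : w ≠ 0) (hτ : ‖shift 𝕜 1 w - w‖ ≤ τ * ‖w‖) {x : ℓ^p(ℤ, E)}
    (hx : ‖T x‖ < ε * ‖x‖) :
    ∃ m, ‖T (localizations hp w x m)‖ < (ε + (α + β) * τ) * ‖localizations hp w x m‖ := by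
  have hα : 0 ≤ α := (norm_nonneg _).trans (hL 0)
  have hβ : 0 ≤ β := (norm_nonneg _).trans (hU 0)
  have hτ' : ‖shift 𝕜 (-1) w - w‖ ≤ τ * ‖w‖ := by
    have heq : shift 𝕜 1 (shift 𝕜 (-1) w - w) = w - shift 𝕜 1 w := by
      ext k
      simp
    rwa [← (shift 𝕜 1).norm_map, heq, norm_sub_rev]
  have hY : ‖lp.mapCLM p L hα hL (shift 𝕜 (-1) x)‖ ≤ α * ‖x‖ := by
    simpa using (lp.mapCLM p L hα hL).le_of_opNorm_le (lp.norm_mapCLM_le p L hα hL) (shift 𝕜 (-1) x)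
  have hZ : ‖lp.mapCLM p U hβ hU (shift 𝕜 1 x)‖ ≤ β * ‖x‖ := by
    simpa using (lp.mapCLM p U hβ hU).le_of_opNorm_le (lp.norm_mapCLM_le p U hβ hU) (shift 𝕜 1 x)
  simp only [apply_localizations_eq_add hp hα hβ hL hU hT]
  refine exists_norm_apply_lt ((norm_add₃_le).trans_lt ?_)
  simp only [norm_localizations]
  have : 0 < ‖w‖ := norm_pos_iff.2 hw
  have hτw : 0 ≤ τ * ‖w‖ := (norm_nonneg _).trans hτ
  calc
    ‖w‖ * ‖T x‖ + ‖shift 𝕜 (-1) w - w‖ * ‖lp.mapCLM p L hα hL (shift 𝕜 (-1) x)‖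
        + ‖shift 𝕜 1 w - w‖ * ‖lp.mapCLM p U hβ hU (shift 𝕜 1 x)‖
      ≤ ‖w‖ * ‖T x‖ + τ * ‖w‖ * (α * ‖x‖) + τ * ‖w‖ * (β * ‖x‖) := by gcongr
    _ < ‖w‖ * (ε * ‖x‖) + τ * ‖w‖ * (α * ‖x‖) + τ * ‖w‖ * (β * ‖x‖) := by gcongr
    _ = (ε + (α + β) * τ) * (‖w‖ * ‖x‖) := by ring

end Localization

section SineWindow

/-- The window `1 ≤ i ≤ N ↦ sin (i π / (N + 1))`, extended by zero: the ground state of the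
discrete Dirichlet Laplacian on `{1, …, N}`. -/
def sineWindow (N : ℕ) : ℓ^2(ℤ, ℝ) :=
  ⟨(Set.Icc (1 : ℤ) N).indicator fun i ↦ Real.sin (i * (Real.pi / (N + 1))),
    (memℓp_zero ((Set.finite_Icc 1 (N : ℤ)).subset Set.support_indicator_subset)).of_exponent_ge
      zero_le⟩

theorem coe_sineWindow (N : ℕ) : (sineWindow N : ℤ → ℝ) =
    (Set.Icc (1 : ℤ) N).indicator fun i ↦ Real.sin (i * (Real.pi / (N + 1))) :=
  rfl

theorem sineWindow_of_notMem {N : ℕ} {i : ℤ} (hi : i ∉ Set.Icc (1 : ℤ) N) : sineWindow N i = 0 := by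
  rw [coe_sineWindow, Set.indicator_of_notMem hi]

theorem sineWindow_of_mem_Icc {N : ℕ} {i : ℤ} (hi : i ∈ Set.Icc (0 : ℤ) (N + 1)) :
    sineWindow N i = Real.sin (i * (Real.pi / (N + 1))) := by
  by_cases hmem : i ∈ Set.Icc (1 : ℤ) N
  · rw [coe_sineWindow, Set.indicator_of_mem hmem]
  rw [sineWindow_of_notMem hmem]
  obtain rfl | rfl : i = 0 ∨ i = N + 1 := by
    simp only [Set.mem_Icc] at hi hmem
    lia
  · simp
  · push_cast
    rw [mul_div_cancel₀ _ (by positivity), Real.sin_pi]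

theorem sineWindow_ne_zero {N : ℕ} (hN : 0 < N) : sineWindow N ≠ 0 := by
  intro h
  have hval : sineWindow N 1 = 0 := by rw [h]; rfl
  rw [sineWindow_of_mem_Icc (by simp), Int.cast_one, one_mul] at hval
  refine (Real.sin_pos_of_pos_of_lt_pi (by positivity) ?_).ne' hval
  exact div_lt_self Real.pi_pos (by simpa using hN)

theorem sineWindow_mul_add_eq (N : ℕ) (i : ℤ) :
    sineWindow N i * (sineWindow N (i + 1) + sineWindow N (i - 1)) =
      2 * Real.cos (Real.pi / (N + 1)) * sineWindow N i ^ 2 := by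
  by_cases hi : i ∈ Set.Icc (1 : ℤ) N
  · obtain ⟨h1, hN⟩ := hi
    rw [sineWindow_of_mem_Icc ⟨by lia, by lia⟩, sineWindow_of_mem_Icc ⟨by lia, by lia⟩,
      sineWindow_of_mem_Icc ⟨by lia, by lia⟩]
    push_cast
    rw [add_mul, sub_mul, one_mul, Real.sin_add, Real.sin_sub]
    ring
  · simp [sineWindow_of_notMem hi]

theorem two_mul_inner_shift_sineWindow (N : ℕ) :
    2 * ⟪shift ℝ 1 (sineWindow N), sineWindow N⟫_ℝ =
      2 * Real.cos (Real.pi / (N + 1)) * ‖sineWindow N‖ ^ 2 := by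
  have hback : ⟪shift ℝ 1 (sineWindow N), sineWindow N⟫_ℝ =
      ⟪shift ℝ (-1) (sineWindow N), sineWindow N⟫_ℝ := by
    rw [← (shift ℝ (-1)).inner_map_map, real_inner_comm]
    congr 1
    ext i
    simp
  calc
    2 * ⟪shift ℝ 1 (sineWindow N), sineWindow N⟫_ℝ
      = ⟪shift ℝ 1 (sineWindow N) + shift ℝ (-1) (sineWindow N), sineWindow N⟫_ℝ := by
        rw [inner_add_left, ← hback, two_mul]
    _ = ⟪(2 * Real.cos (Real.pi / (N + 1))) • sineWindow N, sineWindow N⟫_ℝ := by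
        simp only [lp.inner_eq_tsum]
        refine tsum_congr fun i ↦ ?_
        simpa [sq, mul_assoc, mul_left_comm, ← sub_eq_add_neg] using sineWindow_mul_add_eq N i
    _ = 2 * Real.cos (Real.pi / (N + 1)) * ‖sineWindow N‖ ^ 2 := by
        rw [real_inner_smul_left, real_inner_self_eq_norm_sq]

theorem norm_shift_sineWindow_sub (N : ℕ) :
    ‖shift ℝ 1 (sineWindow N) - sineWindow N‖ =
      2 * Real.sin (Real.pi / (2 * N + 2)) * ‖sineWindow N‖ := by
  have hsin : 0 ≤ Real.sin (Real.pi / (2 * N + 2)) :=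
    Real.sin_nonneg_of_nonneg_of_le_pi (by positivity)
      (div_le_self Real.pi_pos.le (by linarith [N.cast_nonneg (α := ℝ)]))
  have hangle : 2 * (Real.pi / (2 * N + 2)) = Real.pi / (N + 1) := by
    field_simp
  rw [← sq_eq_sq₀ (norm_nonneg _) (by positivity), norm_sub_sq_real,
    two_mul_inner_shift_sineWindow, LinearIsometryEquiv.norm_map, mul_pow, mul_pow,
    Real.sin_sq_eq_half_sub, hangle]
  ring

end SineWindow

section OperatorMatrix

variable {𝕜 ι E : Type*} [NontriviallyNormedField 𝕜] [NormedAddCommGroup E] [NormedSpace 𝕜 E]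
  {p : ℝ≥0∞} [Fact (1 ≤ p)] [DecidableEq ι]

/-- The operator-valued matrix entries `T_{kl} : E → E` of an operator on `ℓ^p(ι, E)`. -/
def matrixEntry (T : ℓ^p(ι, E) →L[𝕜] ℓ^p(ι, E)) (k l : ι) : E →L[𝕜] E :=
  lp.evalCLM 𝕜 (fun _ ↦ E) p k ∘L T ∘L lp.singleContinuousLinearMap 𝕜 (fun _ ↦ E) p l

@[simp]
theorem matrixEntry_apply (T : ℓ^p(ι, E) →L[𝕜] ℓ^p(ι, E)) (k l : ι) (v : E) :
    matrixEntry T k l v = T (lp.single p l v) k :=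
  rfl

theorem norm_matrixEntry_le (T : ℓ^p(ι, E) →L[𝕜] ℓ^p(ι, E)) (k l : ι) :
    ‖matrixEntry T k l‖ ≤ ‖T‖ := by
  refine ContinuousLinearMap.opNorm_le_bound _ (norm_nonneg T) fun v ↦ ?_
  have hv : ‖(lp.single p l v : ℓ^p(ι, E))‖ = ‖v‖ :=
    lp.norm_single (E := fun _ ↦ E) (zero_lt_one.trans_le Fact.out) l v
  rw [matrixEntry_apply, ← hv]
  exact (lp.norm_apply_le_norm ne_zero_of_fact_one_le _ k).trans (T.le_opNorm _)

theorem hasSum_matrixEntry (hp : p ≠ ∞) (T : ℓ^p(ι, E) →L[𝕜] ℓ^p(ι, E)) (x : ℓ^p(ι, E)) (k : ι) :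
    HasSum (fun l ↦ matrixEntry T k l (x l)) (T x k) :=
  (T.hasSum (lp.hasSum_single hp x)).mapL (lp.evalCLM 𝕜 (fun _ ↦ E) p k)

theorem matrixEntry_sub_smul_one_of_ne (T : ℓ^p(ι, E) →L[𝕜] ℓ^p(ι, E)) (a : 𝕜) {k l : ι}
    (h : k ≠ l) : matrixEntry (T - a • 1) k l = matrixEntry T k l := by
  ext v
  have hzero : (lp.single p l v : ℓ^p(ι, E)) k = 0 :=
    lp.single_apply_ne (E := fun _ ↦ E) p l v h
  change T (lp.single p l v) k - a • (lp.single p l v : ℓ^p(ι, E)) k = T (lp.single p l v) k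
  rw [hzero, smul_zero, sub_zero]

end OperatorMatrix

section Tridiagonal

variable {𝕜 E : Type*} [NontriviallyNormedField 𝕜] [NormedAddCommGroup E] [NormedSpace 𝕜 E]
  {p : ℝ≥0∞} [Fact (1 ≤ p)]

/-- An operator on `ℓ^p(ℤ, E)` whose operator matrix is supported on the main diagonal and the
two diagonals next to it. -/
def IsTridiagonal (T : ℓ^p(ℤ, E) →L[𝕜] ℓ^p(ℤ, E)) : Prop :=
  ∀ ⦃k l : ℤ⦄, 2 ≤ |k - l| → matrixEntry T k l = 0

/-- The size `sup_l ‖T_{l+1,l}‖ + sup_l ‖T_{l-1,l}‖` of the two off-diagonals of `T`. -/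
def offDiagonalNorm (T : ℓ^p(ℤ, E) →L[𝕜] ℓ^p(ℤ, E)) : ℝ :=
  (⨆ l, ‖matrixEntry T (l + 1) l‖) + ⨆ l, ‖matrixEntry T (l - 1) l‖

theorem bddAbove_norm_matrixEntry (T : ℓ^p(ℤ, E) →L[𝕜] ℓ^p(ℤ, E)) (s : ℤ → ℤ) :
    BddAbove (Set.range fun l ↦ ‖matrixEntry T (s l) l‖) :=
  ⟨‖T‖, Set.forall_mem_range.2 fun _ ↦ norm_matrixEntry_le T _ _⟩

theorem offDiagonalNorm_sub_smul_one (T : ℓ^p(ℤ, E) →L[𝕜] ℓ^p(ℤ, E)) (a : 𝕜) :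
    offDiagonalNorm (T - a • 1) = offDiagonalNorm T := by
  simp [offDiagonalNorm, matrixEntry_sub_smul_one_of_ne]

namespace IsTridiagonal

theorem sub_smul_one {T : ℓ^p(ℤ, E) →L[𝕜] ℓ^p(ℤ, E)} (hT : IsTridiagonal T) (a : 𝕜) :
    IsTridiagonal (T - a • 1) := fun k l h ↦ by
  have hne : k ≠ l := by
    rintro rfl
    simp at h
  rw [matrixEntry_sub_smul_one_of_ne T a hne, hT h]

theorem apply_eq (hp : p ≠ ∞) {T : ℓ^p(ℤ, E) →L[𝕜] ℓ^p(ℤ, E)} (hT : IsTridiagonal T)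
    (x : ℓ^p(ℤ, E)) (k : ℤ) :
    T x k = matrixEntry T k (k - 1) (x (k - 1)) + matrixEntry T k k (x k) +
      matrixEntry T k (k + 1) (x (k + 1)) := by
  have hzero : ∀ l ∉ ({k - 1, k, k + 1} : Finset ℤ), matrixEntry T k l (x l) = 0 := by
    intro l hl
    simp only [Finset.mem_insert, Finset.mem_singleton, not_or] at hl
    rw [hT (by rw [le_abs]; lia), zero_apply]
  rw [(hasSum_matrixEntry hp T x k).unique (hasSum_sum_of_ne_finset_zero hzero),
    Finset.sum_insert (by simp; lia), Finset.sum_insert (by simp), Finset.sum_singleton, add_assoc]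

end IsTridiagonal

end Tridiagonal

section Adjoint

variable {𝕜 ι H : Type*} [RCLike 𝕜] [NormedAddCommGroup H] [InnerProductSpace 𝕜 H]
  [CompleteSpace H]

open ContinuousLinearMap

theorem matrixEntry_adjoint [DecidableEq ι] (T : ℓ^2(ι, H) →L[𝕜] ℓ^2(ι, H)) (k l : ι) :
    matrixEntry (adjoint T) k l = adjoint (matrixEntry T l k) := by
  rw [eq_adjoint_iff]
  intro v w
  calc
    ⟪adjoint T (lp.single 2 l v) k, w⟫_𝕜 = ⟪adjoint T (lp.single 2 l v), lp.single 2 k w⟫_𝕜 :=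
      (lp.inner_single_right (G := fun _ ↦ H) k w _).symm
    _ = ⟪lp.single 2 l v, T (lp.single 2 k w)⟫_𝕜 := adjoint_inner_left T _ _
    _ = ⟪v, T (lp.single 2 k w) l⟫_𝕜 :=
      lp.inner_single_left (G := fun _ ↦ H) l v _

theorem offDiagonalNorm_adjoint (T : ℓ^2(ℤ, H) →L[𝕜] ℓ^2(ℤ, H)) :
    offDiagonalNorm (adjoint T) = offDiagonalNorm T := by
  simp only [offDiagonalNorm, matrixEntry_adjoint, LinearIsometryEquiv.norm_map]
  rw [← (Equiv.subRight (1 : ℤ)).iSup_comp, ← (Equiv.addRight (1 : ℤ)).iSup_comp (g := fun l ↦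
    ‖matrixEntry T l (l - 1)‖), add_comm]
  simp

theorem IsTridiagonal.adjoint {T : ℓ^2(ℤ, H) →L[𝕜] ℓ^2(ℤ, H)} (hT : IsTridiagonal T) :
    IsTridiagonal (adjoint T) := fun k l h ↦ by
  rw [matrixEntry_adjoint, hT (by rwa [abs_sub_comm]), map_zero]

end Adjoint

theorem IsTridiagonal.exists_window_norm_apply_lt {E : Type*} [NormedAddCommGroup E]
    [NormedSpace ℂ E] {T : ℓ^2(ℤ, E) →L[ℂ] ℓ^2(ℤ, E)} (hT : IsTridiagonal T) {N : ℕ} (hN : 0 < N)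
    {x : ℓ^2(ℤ, E)} {ε : ℝ} (hx : ‖T x‖ < ε * ‖x‖) :
    ∃ (y : ℓ^2(ℤ, E)) (m : ℤ), (∀ k ∉ Set.Icc (m + 1) (m + N), y k = 0) ∧
      ‖T y‖ < (ε + 2 * offDiagonalNorm T * Real.sin (Real.pi / (2 * N + 2))) * ‖y‖ := by
  have hL (k : ℤ) : ‖(matrixEntry T k (k - 1)).restrictScalars ℝ‖ ≤
      ⨆ l, ‖matrixEntry T (l + 1) l‖ := by
    simpa using le_ciSup (bddAbove_norm_matrixEntry T (· + 1)) (k - 1)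
  have hU (k : ℤ) : ‖(matrixEntry T k (k + 1)).restrictScalars ℝ‖ ≤
      ⨆ l, ‖matrixEntry T (l - 1) l‖ := by
    simpa using le_ciSup (bddAbove_norm_matrixEntry T (· - 1)) (k + 1)
  obtain ⟨m, hm⟩ := exists_norm_apply_localizations_lt ENNReal.ofNat_ne_top hL hU
    (D := fun k ↦ (matrixEntry T k k).restrictScalars ℝ)
    (hT.apply_eq ENNReal.ofNat_ne_top) (sineWindow_ne_zero hN) (norm_shift_sineWindow_sub N).le hx
  refine ⟨_, m, fun k hk ↦ ?_, hm.trans_eq ?_⟩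
  · rw [localizations_apply, sineWindow_of_notMem (by rw [Set.mem_Icc] at hk ⊢; lia), zero_smul]
  · rw [offDiagonalNorm]
    ring

section Blocks

variable {b : ℕ} [NeZero b] {c : ℤ}

variable (b c) in
/-- The enumeration `(k, p) ↦ c + b * k + 1 + p` of `ℤ` by blocks of length `b`, for the
offset `c`. -/
def blockEquiv : ℤ × Fin b ≃ ℤ :=
  (Int.divModEquiv b).symm.trans (Equiv.addLeft (c + 1))

theorem blockEquiv_apply (k : ℤ) (p : Fin b) : blockEquiv b c (k, p) = c + b * k + 1 + (p : ℕ) := by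
  simp only [blockEquiv, Equiv.trans_apply, Int.divModEquiv_symm_apply, Equiv.coe_addLeft]
  ring

theorem lt_abs_blockEquiv_sub {k l : ℤ} (h : 2 ≤ |k - l|) (p q : Fin b) :
    b < |blockEquiv b c (k, p) - blockEquiv b c (l, q)| := by
  rw [blockEquiv_apply, blockEquiv_apply]
  have := p.2
  have := q.2
  rw [le_abs] at h
  rw [lt_abs]
  rcases h with h | h
  · left; nlinarith
  · right; nlinarith

variable (b c) in
/-- The partition of a sequence in `ℓ²(ℤ)` into blocks of length `b`, for the offset `c`. -/
def blocks : L2Z ≃ₗᵢ[ℂ] ℓ^2(ℤ, ℓ^2(Fin b, ℂ)) :=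
  (reindex ℂ (blockEquiv b c)).trans (curry ℂ ENNReal.ofNat_ne_top)

@[simp]
theorem blocks_apply (x : L2Z) (k : ℤ) (p : Fin b) :
    blocks b c x k p = x (blockEquiv b c (k, p)) :=
  rfl

theorem blocks_symm_single (l : ℤ) (q : Fin b) :
    (blocks b c).symm (lp.single 2 l (lp.single 2 q 1)) =
      lp.single 2 (blockEquiv b c (l, q)) 1 := by
  rw [LinearIsometryEquiv.symm_apply_eq]
  ext k p
  rw [blocks_apply, lp.single_apply, lp.single_apply, Pi.single_apply, Pi.single_apply]
  obtain rfl | h := eq_or_ne k l <;> simp [*, Pi.single_apply]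

variable (b c) in
/-- An operator on `ℓ²(ℤ)`, viewed as an operator on the sequences of blocks of length `b`. -/
def blockOperator (A : L2Z →L[ℂ] L2Z) : ℓ^2(ℤ, ℓ^2(Fin b, ℂ)) →L[ℂ] ℓ^2(ℤ, ℓ^2(Fin b, ℂ)) :=
  (blocks b c).conjStarAlgEquiv A

@[simp]
theorem blockOperator_apply (A : L2Z →L[ℂ] L2Z) (X : ℓ^2(ℤ, ℓ^2(Fin b, ℂ))) :
    blockOperator b c A X = blocks b c (A ((blocks b c).symm X)) :=
  rfl

theorem matrixEntry_blockOperator_single (A : L2Z →L[ℂ] L2Z) (k l : ℤ) (p q : Fin b) :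
    matrixEntry (blockOperator b c A) k l (lp.single 2 q 1) p =
      entry A (blockEquiv b c (k, p)) (blockEquiv b c (l, q)) := by
  rw [matrixEntry_apply, blockOperator_apply, blocks_apply, blocks_symm_single, entry]

theorem matrixEntry_blockOperator (A : L2Z →L[ℂ] L2Z) (k l : ℤ) :
    matrixEntry (blockOperator b c A) k l = (lpPiLpₗᵢ (fun _ ↦ ℂ) ℂ).symm.conjStarAlgEquiv
      (Matrix.toEuclideanCLM (n := Fin b) (𝕜 := ℂ) (block A b c k l)) := by
  refine lp.ext_continuousLinearMap ENNReal.ofNat_ne_top fun q ↦ ContinuousLinearMap.ext_ring ?_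
  ext p
  refine (matrixEntry_blockOperator_single A k l p q).trans ?_
  change _ = Matrix.toEuclideanCLM (n := Fin b) (𝕜 := ℂ) (block A b c k l)
    (WithLp.toLp 2 (Pi.single q 1)) p
  rw [Matrix.toEuclideanCLM_toLp, Matrix.mulVec_single_one, blockEquiv_apply, blockEquiv_apply]
  rfl

theorem norm_matrixEntry_blockOperator (A : L2Z →L[ℂ] L2Z) (k l : ℤ) :
    ‖matrixEntry (blockOperator b c A) k l‖ = opNorm (block A b c k l) := by
  rw [matrixEntry_blockOperator, opNorm, LinearIsometryEquiv.conjStarAlgEquiv_apply,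
    ContinuousLinearMap.opNorm_linearIsometryEquiv_comp,
    ContinuousLinearMap.opNorm_comp_linearIsometryEquiv]

theorem delta_eq (A : L2Z →L[ℂ] L2Z) (N : ℕ) :
    delta A b c N =
      2 * offDiagonalNorm (blockOperator b c A) * Real.sin (Real.pi / (2 * N + 2)) := by
  simp only [delta, offDiagonalNorm, norm_matrixEntry_blockOperator]

theorem isTridiagonal_blockOperator {A : L2Z →L[ℂ] L2Z}
    (hA : ∀ i j, entry A i j ≠ 0 → |i - j| ≤ b) : IsTridiagonal (blockOperator b c A) := by
  intro k l hkl
  refine lp.ext_continuousLinearMap ENNReal.ofNat_ne_top fun q ↦ ContinuousLinearMap.ext_ring ?_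
  ext p
  refine (matrixEntry_blockOperator_single A k l p q).trans ?_
  by_contra hne
  exact (hA _ _ hne).not_gt (lt_abs_blockEquiv_sub hkl p q)

theorem mem_l2On_window {y : L2Z} {m : ℤ} {N : ℕ}
    (hy : ∀ k ∉ Set.Icc (m + 1) (m + N), blocks b c y k = 0) :
    y ∈ l2On (window (N * b) (c + b * (m + 1))) := by
  intro j hj
  obtain ⟨⟨k, p⟩, rfl⟩ := (blockEquiv b c).surjective j
  rw [← blocks_apply, hy k, lp.coeFn_zero, Pi.zero_apply]
  contrapose! hj
  rw [Set.mem_Icc] at hj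
  have hp := p.2
  have hlower : (b : ℤ) * (m + 1) ≤ b * k := by gcongr; exact hj.1
  have hupper : (b : ℤ) * k ≤ b * (m + N) := by gcongr; exact hj.2
  rw [blockEquiv_apply]
  simp only [window, Set.mem_Icc]
  push_cast
  constructor
  · omega
  · nlinarith

end Blocks

section Windows

open ContinuousLinearMap

variable {A : L2Z →L[ℂ] L2Z} {b : ℕ} [NeZero b] {c : ℤ} {N : ℕ} {ε : ℝ}

theorem nontrivial_l2On {J : Set ℤ} (hJ : J.Nonempty) : Nontrivial (l2On J) := by
  obtain ⟨j, hj⟩ := hJ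
  let e : l2On J := ⟨lp.single 2 j 1, fun i hi ↦ by
    rw [lp.single_apply, Pi.single_eq_of_ne (ne_of_mem_of_not_mem hj hi).symm]⟩
  refine nontrivial_of_ne e 0 fun he ↦ one_ne_zero (α := ℂ) ?_
  rw [← lp.single_apply_self (E := fun _ : ℤ ↦ ℂ) 2 j 1]
  exact congrArg (fun x : l2On J ↦ (x : L2Z) j) he

instance : Nontrivial L2Z :=
  have := nontrivial_l2On Set.univ_nonempty
  (Subtype.val_injective (p := (· ∈ l2On Set.univ))).nontrivial

theorem window_nonempty {n : ℕ} (hn : 0 < n) (k : ℤ) : (window n k).Nonempty :=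
  Set.nonempty_Icc.2 (by lia)

theorem mem_pseudospectrum_iff (hε : 0 < ε) {lam : ℂ} :
    lam ∈ pseudospectrum A ε ↔
      min (lowerNorm (A - lam • 1)) (lowerNorm (adjoint (A - lam • 1))) < ε :=
  not_isUnit_or_lt_norm_inverse_iff _ hε

theorem lowerNorm_le_lowerNorm_restrictTo (B : L2Z →L[ℂ] L2Z) {J : Set ℤ} (hJ : J.Nonempty) :
    lowerNorm B ≤ lowerNorm (restrictTo B J) := by
  have := nontrivial_l2On hJ
  exact (le_lowerNorm_iff _).2 fun x ↦ (le_lowerNorm_iff B).1 le_rfl x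

theorem gammaSet_subset_pseudospectrum (A : L2Z →L[ℂ] L2Z) {n : ℕ} (hn : 0 < n) (M : Set ℤ)
    (hε : 0 < ε) : gammaSet A n M ε ⊆ pseudospectrum A ε := by
  refine Set.iUnion₂_subset fun k _ lam hlam ↦ ?_
  have hJ := window_nonempty hn k
  exact (mem_pseudospectrum_iff hε).2 ((min_le_min (lowerNorm_le_lowerNorm_restrictTo _ hJ)
    (lowerNorm_le_lowerNorm_restrictTo _ hJ)).trans_lt hlam)

theorem gammaSet_mono (A : L2Z →L[ℂ] L2Z) (n : ℕ) (M : Set ℤ) {ε ε' : ℝ} (h : ε ≤ ε') :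
    gammaSet A n M ε ⊆ gammaSet A n M ε' :=
  Set.iUnion₂_mono fun _ _ _ hlam ↦ lt_of_lt_of_le hlam h

theorem exists_lowerNorm_restrictTo_lt (hA : IsTridiagonal (blockOperator b c A)) (hN : 0 < N)
    (hε : lowerNorm A < ε) :
    ∃ k ∈ offsetSet b c, lowerNorm (restrictTo A (window (N * b) k)) < ε + delta A b c N := by
  obtain ⟨x, hx⟩ := (lowerNorm_lt_iff A).1 hε
  have hX : ‖blockOperator b c A (blocks b c x)‖ < ε * ‖blocks b c x‖ := by simpa using hx
  obtain ⟨y, m, hy, hlt⟩ := hA.exists_window_norm_apply_lt hN hX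
  have hmem : (blocks b c).symm y ∈ l2On (window (N * b) (c + b * (m + 1))) :=
    mem_l2On_window fun k hk ↦ by rw [LinearIsometryEquiv.apply_symm_apply, hy k hk]
  have := nontrivial_l2On (window_nonempty (Nat.mul_pos hN (NeZero.pos b)) (c + b * (m + 1)))
  refine ⟨c + b * (m + 1), ⟨m + 1, rfl⟩, (lowerNorm_lt_iff _).2 ⟨⟨_, hmem⟩, ?_⟩⟩
  rw [delta_eq]
  simpa [restrictTo] using hlt

theorem blockOperator_sub_smul_one (A : L2Z →L[ℂ] L2Z) (a : ℂ) :
    blockOperator b c (A - a • 1) = blockOperator b c A - a • 1 := by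
  simp only [blockOperator, map_sub, map_smul, map_one]

theorem blockOperator_adjoint (A : L2Z →L[ℂ] L2Z) :
    blockOperator b c (adjoint A) = adjoint (blockOperator b c A) :=
  map_star (blocks b c).conjStarAlgEquiv A

theorem delta_sub_smul_one (A : L2Z →L[ℂ] L2Z) (a : ℂ) :
    delta (A - a • 1) b c N = delta A b c N := by
  rw [delta_eq, delta_eq, blockOperator_sub_smul_one, offDiagonalNorm_sub_smul_one]

theorem delta_adjoint (A : L2Z →L[ℂ] L2Z) : delta (adjoint A) b c N = delta A b c N := by
  rw [delta_eq, delta_eq, blockOperator_adjoint, offDiagonalNorm_adjoint]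

theorem pseudospectrum_subset_gammaSet (hA : IsTridiagonal (blockOperator b c A)) (hN : 0 < N)
    (hε : 0 < ε) :
    pseudospectrum A ε ⊆ gammaSet A (N * b) (offsetSet b c) (ε + delta A b c N) := by
  intro lam hlam
  have hB : IsTridiagonal (blockOperator b c (A - lam • 1)) := by
    rw [blockOperator_sub_smul_one]
    exact hA.sub_smul_one lam
  have hB' : IsTridiagonal (blockOperator b c (adjoint (A - lam • 1))) := by
    rw [blockOperator_adjoint]
    exact hB.adjoint
  rw [mem_pseudospectrum_iff hε, min_lt_iff] at hlam
  rw [gammaSet, Set.mem_iUnion₂]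
  rcases hlam with h | h
  · obtain ⟨k, hk, hlt⟩ := exists_lowerNorm_restrictTo_lt hB hN h
    rw [delta_sub_smul_one] at hlt
    exact ⟨k, hk, min_lt_of_left_lt hlt⟩
  · obtain ⟨k, hk, hlt⟩ := exists_lowerNorm_restrictTo_lt hB' hN h
    rw [delta_adjoint, delta_sub_smul_one] at hlt
    exact ⟨k, hk, min_lt_of_right_lt hlt⟩

end Windows

theorem abs_sub_le_of_entry_ne_zero {A : L2Z →L[ℂ] L2Z} (hA : IsBandOperator A) {b : ℕ}
    (hb : bandwidth A ≤ b) {i j : ℤ} (h : entry A i j ≠ 0) : |i - j| ≤ b := by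
  have hbdd : BddAbove {m : ℕ | ∃ i j : ℤ, entry A i j ≠ 0 ∧ m = (i - j).natAbs} := by
    refine ((hA.image Int.natAbs).subset ?_).bddAbove
    rintro _ ⟨i, j, hij, rfl⟩
    exact ⟨i - j, ⟨i, j, hij, rfl⟩, rfl⟩
  rw [Int.abs_eq_natAbs, Int.ofNat_le]
  exact (le_csSup hbdd ⟨i, j, h, rfl⟩).trans hb

open Asymptotics

theorem delta_isBigO (A : L2Z →L[ℂ] L2Z) (b : ℕ) (c : ℤ) :
    (fun N : ℕ ↦ delta A b c N) =O[Filter.atTop] fun N : ℕ ↦ 1 / (N : ℝ) := by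
  refine IsBigO.const_mul_left (.of_bound (Real.pi / 2) ?_) _
  filter_upwards [Filter.eventually_gt_atTop 0] with N hN
  have : (0 : ℝ) < N := Nat.cast_pos.2 hN
  rw [Real.norm_eq_abs, Real.norm_of_nonneg (by positivity), div_mul_div_comm, mul_one]
  calc |Real.sin (Real.pi / (2 * N + 2))| ≤ |Real.pi / (2 * N + 2)| := Real.abs_sin_le_abs
    _ = Real.pi / (2 * N + 2) := abs_of_nonneg (by positivity)
    _ ≤ Real.pi / (2 * N) := by gcongr; simp

theorem isBigO_one_div_natCast_mul {b : ℕ} (hb : b ≠ 0) (l : Filter ℕ) :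
    (fun N : ℕ ↦ 1 / (N : ℝ)) =O[l] fun N : ℕ ↦ 1 / ((N * b : ℕ) : ℝ) := by
  have hb : (b : ℝ)⁻¹ ≠ 0 := inv_ne_zero (Nat.cast_ne_zero.2 hb)
  simpa [mul_comm] using (isBigO_refl (fun N : ℕ ↦ (N : ℝ)⁻¹) l).const_mul_right hb

end BandOp

end

theorem mainTheorem2 (A : BandOp.L2Z →L[ℂ] BandOp.L2Z) (hA : BandOp.IsBandOperator A)
    (b : ℕ) (hb : 0 < b) (hbw : BandOp.bandwidth A ≤ b) :
    (∀ N : ℕ, 0 < N → ∀ ε : ℝ, 0 < ε →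
      -- for every single offset
      (∀ c : Fin b,
        BandOp.gammaSet A (N * b) (BandOp.offsetSet b (c : ℕ)) ε ⊆ BandOp.pseudospectrum A ε ∧
        BandOp.pseudospectrum A ε ⊆
          BandOp.gammaSet A (N * b) (BandOp.offsetSet b (c : ℕ))
            (ε + BandOp.delta A b (c : ℕ) N)) ∧
      -- union and intersection over all offsets, each with its own error bound
      (⋃ c : Fin b, BandOp.gammaSet A (N * b) (BandOp.offsetSet b (c : ℕ)) ε) ⊆
        BandOp.pseudospectrum A ε ∧
      BandOp.pseudospectrum A ε ⊆
        (⋂ c : Fin b, BandOp.gammaSet A (N * b) (BandOp.offsetSet b (c : ℕ))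
          (ε + BandOp.delta A b (c : ℕ) N)) ∧
      -- the same with one common error bound
      BandOp.pseudospectrum A ε ⊆
        (⋂ c : Fin b, BandOp.gammaSet A (N * b) (BandOp.offsetSet b (c : ℕ))
          (ε + ⨆ c' : Fin b, BandOp.delta A b (c' : ℕ) N))) ∧
    -- the rate of the error bounds, as `N → ∞`, in terms of `N` and of `n = N * b`
    (∀ c : Fin b,
      (fun N : ℕ => BandOp.delta A b (c : ℕ) N) =O[Filter.atTop] (fun N : ℕ => 1 / (N : ℝ)) ∧
      (fun N : ℕ => BandOp.delta A b (c : ℕ) N) =O[Filter.atTop]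
        (fun N : ℕ => 1 / ((N * b : ℕ) : ℝ))) := by
  have : NeZero b := ⟨hb.ne'⟩
  have hblock (c : ℤ) : BandOp.IsTridiagonal (BandOp.blockOperator b c A) :=
    BandOp.isTridiagonal_blockOperator fun _ _ ↦ BandOp.abs_sub_le_of_entry_ne_zero hA hbw
  refine ⟨fun N hN ε hε ↦ ?_, fun c ↦ ⟨BandOp.delta_isBigO A b c,
    (BandOp.delta_isBigO A b c).trans (BandOp.isBigO_one_div_natCast_mul hb.ne' _)⟩⟩
  have hlower (c : Fin b) := BandOp.gammaSet_subset_pseudospectrum A (Nat.mul_pos hN hb)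
    (BandOp.offsetSet b (c : ℕ)) hε
  have hupper (c : Fin b) := BandOp.pseudospectrum_subset_gammaSet (hblock (c : ℕ)) hN hε
  have hdelta (c : Fin b) :
      BandOp.delta A b (c : ℕ) N ≤ ⨆ c' : Fin b, BandOp.delta A b (c' : ℕ) N :=
    le_ciSup (f := fun c' : Fin b ↦ BandOp.delta A b (c' : ℕ) N) (Set.finite_range _).bddAbove c
  exact ⟨fun c ↦ ⟨hlower c, hupper c⟩, Set.iUnion_subset hlower, Set.subset_iInter hupper,
    Set.subset_iInter fun c ↦
      (hupper c).trans (BandOp.gammaSet_mono A _ _ (add_le_add_right (hdelta c) ε))⟩
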